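/- Let $u:\mathbb R\to\mathbb R$ be the Hastings–McLeod solution of the Painlevé II equation, i.e. the (unique) solution of $$u''(t)=t\,u(t)+2u(t)^3,\qquad t\in\mathbb R,$$ with $u(t)\to 0$ as $t\to+\infty$ and $u(t)\sim\sqrt{-t/2}$ as $t\to-\infty$. For $t<0$ put $z(t)=u(t)/\sqrt{-t/2}$. Then: 1. If $z$ has a local minimum at a point $t<-\tfrac{11}{8}$, then $z(t)>\sqrt{1203/1331}$. 2. For every $t\in[-\tfrac{11}{8},0)$, $z(t)>\sqrt{1203/1331}$. 3. The function $z$ attains a minimum $m=\min_{t\in(-\infty,0)}z(t)$, and $m>\sqrt{1203/1331}$. There is a smallest real number $k_0$ such that $t+k_0u(t)^2\ge 0$ for all $t\in\mathbb R$; it is positive, it satisfies $k_0=2m^{-2}$, and $$k_0<\frac{2662}{1203}<\frac{10}{3}.$$ -/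

import Mathlib

/-- `u` is a Hastings–McLeod solution of Painlevé II, defined by the boundary value problem on the
whole real line: `u'' = t u + 2 u³`, `u(t) → 0` as `t → +∞`, `u(t) ~ √(-t/2)` as `t → -∞`.
(These conditions determine `u` uniquely.) -/
structure IsHastingsMcLeod (u : ℝ → ℝ) : Prop where
  differentiable : Differentiable ℝ u
  painleve : ∀ t : ℝ, HasDerivAt (deriv u) (t * u t + 2 * u t ^ 3) t
  tendsto_atTop : Filter.Tendsto u Filter.atTop (nhds 0)
  isEquivalent_atBot : Asymptotics.IsEquivalent Filter.atBot u (fun t : ℝ => √(-t / 2))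

/-- The ratio `u(t) / √(-t/2)`; it is only used for `t < 0`. -/
noncomputable def hmRatio (u : ℝ → ℝ) (t : ℝ) : ℝ := u t / √(-t / 2)

/-! Write z = u/√(-t/2). At a local minimum t of z the curve z(t)√(-s/2) touches u from below, and
comparing second derivatives gives z² ≥ 1 - 1/(4|t|³), which exceeds 1203/1331 exactly when t <
-11/8. Nearer the origin this is too weak, and u is bounded below by a quintic p with p'' ≥ tp + 2p³
on [-5/2, 2]: as M³ > M for M > 1, no multiple Mu with M > 1 touches p from above in the interior.
At the right end p(2) < 0; at the left end the estimate on minima of z takes over (`quinticSub_le`).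

Both arguments need u > 0. At a zero, depending on slope and Hamiltonian, ±u rises forever to the
right, or u is bounded to the left, or u vanishes to the left; each contradicts a boundary condition
(`ne_zero`).

Finally k₀ is the maximum of -t/u² over t ≤ 0. For t < 0 this quotient is 2/z²; it tends to 2 at -∞
and exceeds 2 somewhere, so the maximum is attained. -/

/-- The mean value theorem for a function differentiable everywhere. -/
theorem exists_sub_eq_deriv_mul {f f' : ℝ → ℝ} (h : ∀ t, HasDerivAt f (f' t) t) {a b : ℝ}
    (hab : a < b) : ∃ c ∈ Set.Ioo a b, f b - f a = f' c * (b - a) := by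
  obtain ⟨c, hc, hc'⟩ := exists_hasDerivAt_eq_slope f f' hab
    (fun t _ => (h t).continuousAt.continuousWithinAt) (fun t _ => h t)
  refine ⟨c, hc, ?_⟩
  rw [hc', div_mul_cancel₀ _ (sub_pos.2 hab).ne']

/-- The first point to the right of `a` where a continuous function loses its positivity. -/
theorem exists_first_zero {f : ℝ → ℝ} (hf : Continuous f) {a b : ℝ} (hab : a ≤ b) (ha : 0 < f a)
    (hb : f b ≤ 0) : ∃ c, a < c ∧ f c = 0 ∧ ∀ s, a ≤ s → s < c → 0 < f s := by
  have hK : IsCompact (Set.Icc a b ∩ f ⁻¹' Set.Iic 0) :=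
    isCompact_Icc.inter_right (isClosed_Iic.preimage hf)
  obtain ⟨c, ⟨⟨hac, hcb⟩, hc⟩, hmin⟩ := hK.exists_isLeast ⟨b, ⟨hab, le_rfl⟩, hb⟩
  have hc : f c ≤ 0 := hc
  have hlt : a < c := lt_of_le_of_ne hac (by rintro rfl; linarith)
  have hpos : ∀ s, a ≤ s → s < c → 0 < f s := by
    intro s has hsc
    by_contra! hs
    exact absurd (hmin ⟨⟨has, hsc.le.trans hcb⟩, hs⟩) (not_le.2 hsc)
  refine ⟨c, hlt, le_antisymm hc ?_, hpos⟩
  refine ge_of_tendsto (hf.continuousAt.tendsto.mono_left (nhdsWithin_le_nhds (s := Set.Iio c))) ?_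
  filter_upwards [Ico_mem_nhdsLT hlt] with s hs using (hpos s hs.1 hs.2).le

/-- The last point to the left of `a` where a continuous function loses its positivity. -/
theorem exists_last_zero {f : ℝ → ℝ} (hf : Continuous f) {a b : ℝ} (hba : b ≤ a) (ha : 0 < f a)
    (hb : f b ≤ 0) : ∃ c, c < a ∧ f c = 0 ∧ ∀ s, c < s → s ≤ a → 0 < f s := by
  obtain ⟨c, hc, hc0, hpos⟩ := exists_first_zero (f := fun t => f (-t)) (hf.comp continuous_neg)
    (neg_le_neg hba) (by simpa using ha) (by simpa using hb)
  refine ⟨-c, by linarith, hc0, fun s hs hsa => ?_⟩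
  simpa using hpos (-s) (by linarith) (by linarith)

/-- If `f ≤ g` near `t` with equality at `t`, then `f'' t ≤ g'' t`. -/
theorem second_deriv_le_of_touch {f f' g g' : ℝ → ℝ} {f'' g'' t : ℝ}
    (hf : ∀ᶠ s in nhds t, HasDerivAt f (f' s) s) (hf' : HasDerivAt f' f'' t)
    (hg : ∀ᶠ s in nhds t, HasDerivAt g (g' s) s) (hg' : HasDerivAt g' g'' t)
    (hle : ∀ᶠ s in nhds t, f s ≤ g s) (heq : f t = g t) : f'' ≤ g'' := by
  by_contra! hlt
  set φ : ℝ → ℝ := fun s => g s - f s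
  have hφ : ∀ᶠ s in nhds t, HasDerivAt φ (g' s - f' s) s := by
    filter_upwards [hf, hg] with s h1 h2 using h2.sub h1
  have hder : deriv φ =ᶠ[nhds t] fun s => g' s - f' s := hφ.mono fun s h => h.deriv
  have hdd : HasDerivAt (deriv φ) (g'' - f'') t := (hg'.sub hf').congr_of_eventuallyEq hder
  have hmin : IsLocalMin φ t := by
    filter_upwards [hle] with s hs
    simp only [φ, heq, sub_self]
    linarith
  -- A negative second derivative would make the local minimum also a local maximum, so φ would be
  -- locally constant and its second derivative zero.
  have hmax : IsLocalMax φ t := by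
    refine isLocalMax_of_deriv_deriv_neg ?_ hmin.deriv_eq_zero hφ.self_of_nhds.continuousAt
    rw [hdd.deriv]
    linarith
  have hconst : φ =ᶠ[nhds t] fun _ => φ t := by
    filter_upwards [hmin, hmax] with s h1 h2 using le_antisymm h2 h1
  have h0 : deriv φ =ᶠ[nhds t] fun _ => 0 := by
    filter_upwards [hconst.eventuallyEq_nhds] with s hs
    rw [hs.deriv_eq, deriv_const]
  have := hdd.unique ((hasDerivAt_const t (0 : ℝ)).congr_of_eventuallyEq h0)
  linarith

/-! ### Behaviour of Painlevé II solutions near a zero -/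

section PainleveTwo

variable {u v : ℝ → ℝ}

theorem hasDerivAt_defect (hu : ∀ t, HasDerivAt u (v t) t) (t : ℝ) :
    HasDerivAt (fun t => -t / 2 - u t ^ 2) (-1 / 2 - 2 * u t * v t) t := by
  refine (((hasDerivAt_id' t).neg.div_const 2).sub ((hu t).pow 2)).congr_deriv ?_
  simp

/-- The Hamiltonian `u'² - (t/2 + u²)²` of Painlevé II has derivative `-t/2 - u²`. -/
theorem hasDerivAt_hamiltonian (hu : ∀ t, HasDerivAt u (v t) t)
    (hv : ∀ t, HasDerivAt v (t * u t + 2 * u t ^ 3) t) (t : ℝ) :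
    HasDerivAt (fun t => v t ^ 2 - (-t / 2 - u t ^ 2) ^ 2) (-t / 2 - u t ^ 2) t := by
  refine (((hv t).pow 2).sub ((hasDerivAt_defect hu t).pow 2)).congr_deriv ?_
  push_cast
  ring

/-- A solution that rises from a zero with nonnegative Hamiltonian does not tend to `0`. -/
theorem not_tendsto_zero_of_rising (hu : ∀ t, HasDerivAt u (v t) t)
    (hv : ∀ t, HasDerivAt v (t * u t + 2 * u t ^ 3) t) {a : ℝ} (hua : u a = 0) (hva : 0 < v a)
    (ha : 0 ≤ a ∨ 0 ≤ v a ^ 2 - (-a / 2 - u a ^ 2) ^ 2)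
    (hlim : Filter.Tendsto u Filter.atTop (nhds 0)) : False := by
  have cu : Continuous u := continuous_iff_continuousAt.2 fun t => (hu t).continuousAt
  have cv : Continuous v := continuous_iff_continuousAt.2 fun t => (hv t).continuousAt
  have hmono : ∀ b, (∀ s, a ≤ s → s < b → 0 < v s) → ∀ s, a < s → s ≤ b → 0 < u s := by
    intro b hb s has hsb
    obtain ⟨c, hc, h⟩ := exists_sub_eq_deriv_mul hu has
    have := mul_pos (hb c hc.1.le (hc.2.trans_le hsb)) (sub_pos.2 has)
    linarith
  have hvpos : ∀ t, a ≤ t → 0 < v t := by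
    intro t hat
    by_contra! hvt
    obtain ⟨b, hab, hvb, hpos⟩ := exists_first_zero cv hat hva hvt
    have hupos := hmono b hpos
    have hDanti : ∀ x y, a ≤ x → x < y → y ≤ b →
        -y / 2 - u y ^ 2 < -x / 2 - u x ^ 2 := by
      intro x y hax hxy hyb
      obtain ⟨c, hc, h⟩ := exists_sub_eq_deriv_mul (hasDerivAt_defect hu) hxy
      have hac : a < c := hax.trans_lt hc.1
      have hcb : c < b := hc.2.trans_le hyb
      have := mul_pos (hupos c hac hcb.le) (hpos c hac.le hcb)
      nlinarith [sub_pos.2 hxy]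
    -- once the defect is nonpositive, `v` increases up to `b`
    have key : ∀ x, a ≤ x → x < b → 0 < -x / 2 - u x ^ 2 := by
      intro x hax hxb
      by_contra! hx
      obtain ⟨c, hc, h⟩ := exists_sub_eq_deriv_mul hv hxb
      have hDc := hDanti x c hax hc.1 hc.2.le
      have huc := hupos c (hax.trans_lt hc.1) hc.2.le
      have h2 : 0 < c * u c + 2 * u c ^ 3 := by
        have : 0 < u c * (c + 2 * u c ^ 2) := mul_pos huc (by linarith)
        linarith
      have := mul_pos h2 (sub_pos.2 hxb)
      have := hpos x hax hxb
      linarith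
    -- The Hamiltonian increases on `[a, b]`, yet it is at most 0 at `b`, where `v` vanishes. If
    -- instead `0 ≤ a`, the defect is already nonpositive at `a`, against `key`.
    obtain ⟨c, hc, h⟩ := exists_sub_eq_deriv_mul (hasDerivAt_hamiltonian hu hv) hab
    have h1 := mul_pos (key c hc.1.le hc.2) (sub_pos.2 hab)
    replace h : (v b ^ 2 - (-b / 2 - u b ^ 2) ^ 2) - (v a ^ 2 - (-a / 2 - u a ^ 2) ^ 2) =
        (-c / 2 - u c ^ 2) * (b - a) := h
    rcases ha with ha | ha
    · have := key a le_rfl hab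
      nlinarith [sq_nonneg (u a)]
    · rw [hvb] at h
      nlinarith [sq_nonneg (-b / 2 - u b ^ 2)]
  have hpos1 : 0 < u (a + 1) := hmono (a + 1) (fun s h _ => hvpos s h) _ (by linarith) le_rfl
  have hge : ∀ᶠ t in Filter.atTop, u (a + 1) ≤ u t := by
    filter_upwards [Filter.eventually_gt_atTop (a + 1)] with t ht
    obtain ⟨c, hc, h⟩ := exists_sub_eq_deriv_mul hu ht
    have := mul_pos (hvpos c (by linarith [hc.1])) (sub_pos.2 ht)
    linarith
  exact absurd (ge_of_tendsto hlim hge) (not_le.2 hpos1)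

/-- A solution with positive defect `-t/2 - u²` and negative Hamiltonian at some point is bounded
to the left of it. -/
theorem sq_le_of_trapped (hu : ∀ t, HasDerivAt u (v t) t)
    (hv : ∀ t, HasDerivAt v (t * u t + 2 * u t ^ 3) t) {a : ℝ} (hD : 0 < -a / 2 - u a ^ 2)
    (hG : v a ^ 2 - (-a / 2 - u a ^ 2) ^ 2 < 0) {t : ℝ} (hta : t ≤ a) : u t ^ 2 ≤ -a / 2 := by
  have cu : Continuous u := continuous_iff_continuousAt.2 fun t => (hu t).continuousAt
  set D : ℝ → ℝ := fun t => -t / 2 - u t ^ 2 with hDdef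
  set F : ℝ → ℝ := fun t => D t ^ 2 - v t ^ 2 with hFdef
  have hF : ∀ t, HasDerivAt F (-D t) t := by
    intro t
    refine (hasDerivAt_hamiltonian hu hv t).neg.congr_of_eventuallyEq
      (Filter.Eventually.of_forall fun s => ?_)
    simp [hFdef, hDdef]
  have hFa : 0 < F a := by simp only [hFdef, hDdef]; linarith
  have cD : Continuous D := by fun_prop
  have hFmono : ∀ b, (∀ s, b < s → s ≤ a → 0 < D s) → ∀ s, b ≤ s → s ≤ a → F a ≤ F s := by
    intro b hb s hbs hsa
    rcases hsa.eq_or_lt with rfl | hsa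
    · exact le_rfl
    obtain ⟨c, hc, h⟩ := exists_sub_eq_deriv_mul hF hsa
    have := mul_pos (hb c (hbs.trans_lt hc.1) hc.2.le) (sub_pos.2 hsa)
    linarith
  have hDpos : ∀ s, s ≤ a → 0 < D s := by
    intro s hsa
    by_contra! hs
    obtain ⟨b, hba, hDb, hpos⟩ := exists_last_zero cD hsa hD hs
    have := hFmono b hpos b le_rfl hba.le
    have hFb : F b = -v b ^ 2 := by simp [hFdef, hDb]
    nlinarith [sq_nonneg (v b)]
  have hFpos : ∀ s, s ≤ a → 0 < F s := fun s hs =>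
    hFa.trans_le (hFmono s (fun r _ hr => hDpos r hr) s le_rfl hs)
  have hsqrt : ∀ s, s ≤ a → √(F s) ≤ D s := fun s hs =>
    Real.sqrt_le_iff.2 ⟨(hDpos s hs).le, by simp only [hFdef]; nlinarith [sq_nonneg (v s)]⟩
  -- Since `√F ≤ D`, the derivative `-D / (2√F)` of `√F` is at most `-1/2`. The resulting linear
  -- growth of `D` to the left cancels the `-t/2` in `D`.
  have hgrow : (a - t) / 2 ≤ √(F t) := by
    rcases hta.eq_or_lt with rfl | hta
    · simp
    obtain ⟨c, hc, h⟩ := exists_hasDerivAt_eq_slope (fun s => √(F s))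
      (fun s => -D s / (2 * √(F s))) hta
      (fun s _ => (hF s).continuousAt.sqrt.continuousWithinAt)
      (fun s hs => (hF s).sqrt (hFpos s hs.2.le).ne')
    have hFc := Real.sqrt_pos.2 (hFpos c hc.2.le)
    have h1 : -D c / (2 * √(F c)) ≤ -1 / 2 := by
      rw [div_le_div_iff₀ (by positivity) two_pos]
      linarith [hsqrt c hc.2.le]
    rw [h, div_le_div_iff₀ (sub_pos.2 hta) two_pos] at h1
    linarith [Real.sqrt_nonneg (F a)]
  have := hgrow.trans (hsqrt t hta)
  simp only [hDdef] at this
  linarith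

/-- A solution with vanishing initial data vanishes to the left. -/
theorem eq_zero_of_initial_eq_zero (hu : ∀ t, HasDerivAt u (v t) t)
    (hv : ∀ t, HasDerivAt v (t * u t + 2 * u t ^ 3) t) {a : ℝ} (hua : u a = 0) (hva : v a = 0)
    {t : ℝ} (hta : t ≤ a) : u t = 0 := by
  rcases hta.eq_or_lt with rfl | hta
  · exact hua
  have cu : Continuous u := continuous_iff_continuousAt.2 fun t => (hu t).continuousAt
  obtain ⟨K, hK⟩ := isCompact_Icc.exists_bound_of_continuousOn (s := Set.Icc t a)
    (f := fun s => 1 + (s + 2 * u s ^ 2)) (by fun_prop)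
  -- Grönwall: with this weight the energy is nondecreasing on `[t, a]`, and it vanishes at `a`.
  have hder : ∀ s, HasDerivAt (fun s => (u s ^ 2 + v s ^ 2) * Real.exp (K * s))
      ((2 * u s * v s * (1 + (s + 2 * u s ^ 2)) + K * (u s ^ 2 + v s ^ 2)) * Real.exp (K * s))
      s := by
    intro s
    refine ((((hu s).pow 2).add ((hv s).pow 2)).mul
      ((hasDerivAt_id' s).const_mul K).exp).congr_deriv ?_
    simp only [Pi.add_apply, Pi.pow_apply]
    push_cast
    ring
  obtain ⟨c, hc, h⟩ := exists_sub_eq_deriv_mul hder hta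
  have hKc := abs_le.1 (hK c ⟨hc.1.le, hc.2.le⟩)
  have h1 : 0 ≤ 2 * u c * v c * (1 + (c + 2 * u c ^ 2)) + K * (u c ^ 2 + v c ^ 2) := by
    nlinarith [mul_nonneg (sq_nonneg (u c + v c)) (by linarith : 0 ≤ K + (1 + (c + 2 * u c ^ 2))),
      mul_nonneg (sq_nonneg (u c - v c)) (by linarith : 0 ≤ K - (1 + (c + 2 * u c ^ 2)))]
  have h2 := mul_nonneg (mul_nonneg h1 (Real.exp_pos (K * c)).le) (sub_pos.2 hta).le
  rw [← h] at h2
  simp only [hua, hva] at h2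
  have h3 : u t ^ 2 + v t ^ 2 ≤ 0 := by
    by_contra! h3
    nlinarith [mul_pos h3 (Real.exp_pos (K * t))]
  exact pow_eq_zero_iff two_ne_zero |>.1 (le_antisymm (by nlinarith [sq_nonneg (v t)])
    (sq_nonneg (u t)))

end PainleveTwo

/-! ### The polynomial subsolution and its certificates -/

/-- A quintic subsolution of Painlevé II on `[-5/2, 2]`. -/
noncomputable def quinticSub (t : ℝ) : ℝ :=
  (3499 - 3022 * t + 450 * t ^ 2 + 193 * t ^ 3 - 28 * t ^ 4 - 11 * t ^ 5) / 10000

/-- The first derivative of `quinticSub`. -/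
noncomputable def quinticSubDeriv (t : ℝ) : ℝ :=
  (-3022 + 900 * t + 579 * t ^ 2 - 112 * t ^ 3 - 55 * t ^ 4) / 10000

/-- The second derivative of `quinticSub`. -/
noncomputable def quinticSubDeriv2 (t : ℝ) : ℝ :=
  (900 + 1158 * t - 336 * t ^ 2 - 220 * t ^ 3) / 10000

theorem hasDerivAt_quinticSub (t : ℝ) : HasDerivAt quinticSub (quinticSubDeriv t) t := by
  have h := (((((((hasDerivAt_id' t).const_mul 3022).const_sub 3499).add
    (((hasDerivAt_id' t).pow 2).const_mul 450)).add
    (((hasDerivAt_id' t).pow 3).const_mul 193)).sub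
    (((hasDerivAt_id' t).pow 4).const_mul 28)).sub
    (((hasDerivAt_id' t).pow 5).const_mul 11)).div_const 10000
  refine h.congr_deriv ?_
  simp only [quinticSubDeriv]
  push_cast
  ring

theorem hasDerivAt_quinticSubDeriv (t : ℝ) :
    HasDerivAt quinticSubDeriv (quinticSubDeriv2 t) t := by
  have h := ((((((hasDerivAt_id' t).const_mul 900).const_add (-3022)).add
    (((hasDerivAt_id' t).pow 2).const_mul 579)).sub
    (((hasDerivAt_id' t).pow 3).const_mul 112)).sub
    (((hasDerivAt_id' t).pow 4).const_mul 55)).div_const 10000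
  refine h.congr_deriv ?_
  simp only [quinticSubDeriv2]
  push_cast
  ring

/-- Bernstein certificate: `X` and `Y` vanish at the two endpoints and `X + Y` is constant, so the
difference of the two sides can be homogenised to a form in `X, Y` of degree 15. All its
coefficients are positive. The later polynomial bounds use the same device. -/
theorem quinticSub_isSubsolution_left {t : ℝ} (h1 : -(5 / 2) ≤ t) (h2 : t ≤ -(11 / 8)) :
    t * quinticSub t + 2 * quinticSub t ^ 3 ≤ quinticSubDeriv2 t := by
  obtain ⟨X, hX⟩ : ∃ X, X = 8 * t + 20 := ⟨_, rfl⟩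
  obtain ⟨Y, hY⟩ : ∃ Y, Y = -11 - 8 * t := ⟨_, rfl⟩
  have hX0 : 0 ≤ X := by linarith
  have hY0 : 0 ≤ Y := by linarith
  have key : 3622075100704495335829929984000000000000 *
      (quinticSubDeriv2 t - (t * quinticSub t + 2 * quinticSub t ^ 3)) =
      1770875264440693478653952 * Y ^ 15 + 21010568365484912878288896 * X * Y ^ 14 +
      112931353490423332365926400 * X ^ 2 * Y ^ 13 +
      362842025841714364929802240 * X ^ 3 * Y ^ 12 +
      773688914815024153692733440 * X ^ 4 * Y ^ 11 +
      1148391155517008402294243328 * X ^ 5 * Y ^ 10 +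
      1210237011883430647854006272 * X ^ 6 * Y ^ 9 + 910004250808764112398778368 * X ^ 7 * Y ^ 8 +
      494398325483138410119806976 * X ^ 8 * Y ^ 7 + 215393903018280182579228672 * X ^ 9 * Y ^ 6 +
      104115662362968848001813504 * X ^ 10 * Y ^ 5 + 63158062909759721248537344 * X ^ 11 * Y ^ 4 +
      32985890979374904682169536 * X ^ 12 * Y ^ 3 + 11376055942528775523754800 * X ^ 13 * Y ^ 2 +
      2239445823597064798022460 * X ^ 14 * Y + 191457972898679958476711 * X ^ 15 := by
    subst hX hY
    simp only [quinticSub, quinticSubDeriv2]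
    ring
  have hnn : 0 ≤ 3622075100704495335829929984000000000000 *
      (quinticSubDeriv2 t - (t * quinticSub t + 2 * quinticSub t ^ 3)) := key ▸ by positivity
  linarith

theorem quinticSub_isSubsolution_mid {t : ℝ} (h1 : -(11 / 8) ≤ t) (h2 : t ≤ -(1 / 4)) :
    t * quinticSub t + 2 * quinticSub t ^ 3 ≤ quinticSubDeriv2 t := by
  obtain ⟨X, hX⟩ : ∃ X, X = 8 * t + 11 := ⟨_, rfl⟩
  obtain ⟨Y, hY⟩ : ∃ Y, Y = -2 - 8 * t := ⟨_, rfl⟩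
  have hX0 : 0 ≤ X := by linarith
  have hY0 : 0 ≤ Y := by linarith
  have key : 3622075100704495335829929984000000000000 *
      (quinticSubDeriv2 t - (t * quinticSub t + 2 * quinticSub t ^ 3)) =
      191457972898679958476711 * Y ^ 15 + 3504293363363333956278870 * X * Y ^ 14 +
      29083921499256543739344540 * X ^ 2 * Y ^ 13 + 144540305088236721310507864 * X ^ 3 * Y ^ 12 +
      481002023266257573577930800 * X ^ 4 * Y ^ 11 +
      1136883552543568066374533856 * X ^ 5 * Y ^ 10 +
      1974726990718206727106892992 * X ^ 6 * Y ^ 9 +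
      2570278513267820908148814720 * X ^ 7 * Y ^ 8 +
      2530049935268027692489487616 * X ^ 8 * Y ^ 7 +
      1884632216343564042701537792 * X ^ 9 * Y ^ 6 +
      1054020892515736053368312832 * X ^ 10 * Y ^ 5 +
      434690777849430093052053504 * X ^ 11 * Y ^ 4 +
      127987812319034847260446720 * X ^ 12 * Y ^ 3 + 25415936205922922024902656 * X ^ 13 * Y ^ 2 +
      3050210542708928261406720 * X ^ 14 * Y + 167649714262055011647488 * X ^ 15 := by
    subst hX hY
    simp only [quinticSub, quinticSubDeriv2]
    ring
  have hnn : 0 ≤ 3622075100704495335829929984000000000000 *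
      (quinticSubDeriv2 t - (t * quinticSub t + 2 * quinticSub t ^ 3)) := key ▸ by positivity
  linarith

theorem quinticSub_isSubsolution_right {t : ℝ} (h1 : -(1 / 4) ≤ t) (h2 : t ≤ 2) :
    t * quinticSub t + 2 * quinticSub t ^ 3 ≤ quinticSubDeriv2 t := by
  obtain ⟨X, hX⟩ : ∃ X, X = 4 * t + 1 := ⟨_, rfl⟩
  obtain ⟨Y, hY⟩ : ∃ Y, Y = 8 - 4 * t := ⟨_, rfl⟩
  have hX0 : 0 ≤ X := by linarith
  have hY0 : 0 ≤ Y := by linarith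
  have key : 110536959860366678949888000000000000 *
      (quinticSubDeriv2 t - (t * quinticSub t + 2 * quinticSub t ^ 3)) =
      5116263252626190541 * Y ^ 15 + 44061769298541839640 * X * Y ^ 14 +
      118256811944082646128 * X ^ 2 * Y ^ 13 + 131696176874340323072 * X ^ 3 * Y ^ 12 +
      1335558893976714488064 * X ^ 4 * Y ^ 11 + 10621089003267627426816 * X ^ 5 * Y ^ 10 +
      39890905609752153296896 * X ^ 6 * Y ^ 9 + 89301450256745704095744 * X ^ 7 * Y ^ 8 +
      131735745402179301015552 * X ^ 8 * Y ^ 7 + 133598406814823345815552 * X ^ 9 * Y ^ 6 +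
      94234036692017665277952 * X ^ 10 * Y ^ 5 + 45663610719152099033088 * X ^ 11 * Y ^ 4 +
      14596491090547586367488 * X ^ 12 * Y ^ 3 + 2818237547779750625280 * X ^ 13 * Y ^ 2 +
      268287811572335640576 * X ^ 14 * Y + 6120328397873741824 * X ^ 15 := by
    subst hX hY
    simp only [quinticSub, quinticSubDeriv2]
    ring
  have hnn : 0 ≤ 110536959860366678949888000000000000 *
      (quinticSubDeriv2 t - (t * quinticSub t + 2 * quinticSub t ^ 3)) := key ▸ by positivity
  linarith

theorem quinticSub_isSubsolution {t : ℝ} (h1 : -(5 / 2) ≤ t) (h2 : t ≤ 2) :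
    t * quinticSub t + 2 * quinticSub t ^ 3 ≤ quinticSubDeriv2 t := by
  rcases le_total t (-(11 / 8)) with h | h
  · exact quinticSub_isSubsolution_left h1 h
  rcases le_total t (-(1 / 4)) with h' | h'
  · exact quinticSub_isSubsolution_mid h h'
  · exact quinticSub_isSubsolution_right h' h2

theorem lt_quinticSub_sq {t : ℝ} (h1 : -(11 / 8) ≤ t) (h2 : t ≤ 0) :
    1203 / 1331 * (-t / 2) < quinticSub t ^ 2 := by
  obtain ⟨X, hX⟩ : ∃ X, X = 8 * t + 11 := ⟨_, rfl⟩
  obtain ⟨Y, hY⟩ : ∃ Y, Y = 0 - 8 * t := ⟨_, rfl⟩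
  have hX0 : 0 ≤ X := by linarith
  have hY0 : 0 ≤ Y := by linarith
  -- The slack `1/1000` makes the final inequality strict.
  have key : 336986180971376567910400000000 *
      (quinticSub t ^ 2 - 1203 / 1331 * (-t / 2) - 1 / 1000) =
      140311602514489161 * Y ^ 10 + 747421518940946240 * X * Y ^ 9 +
      1251401768000553600 * X ^ 2 * Y ^ 8 + 1472267558483646464 * X ^ 3 * Y ^ 7 +
      8606390231116763136 * X ^ 4 * Y ^ 6 + 31617026986322231296 * X ^ 5 * Y ^ 5 +
      57674879934769659904 * X ^ 6 * Y ^ 4 + 59286195358213865472 * X ^ 7 * Y ^ 3 +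
      35353932351359942656 * X ^ 8 * Y ^ 2 + 11481276929118568448 * X ^ 9 * Y +
      1577652213151432704 * X ^ 10 := by
    subst hX hY
    simp only [quinticSub]
    ring
  have hnn : 0 ≤ 336986180971376567910400000000 *
      (quinticSub t ^ 2 - 1203 / 1331 * (-t / 2) - 1 / 1000) := key ▸ by positivity
  linarith

theorem quinticSub_pos {t : ℝ} (h1 : -(11 / 8) ≤ t) (h2 : t ≤ 0) : 0 < quinticSub t := by
  obtain ⟨X, hX⟩ : ∃ X, X = 8 * t + 11 := ⟨_, rfl⟩
  obtain ⟨Y, hY⟩ : ∃ Y, Y = 0 - 8 * t := ⟨_, rfl⟩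
  have hX0 : 0 ≤ X := by linarith
  have hY0 : 0 ≤ Y := by linarith
  have key : 52773191680000 *
      (quinticSub t - 1 / 1000) =
      260416649 * Y ^ 5 + 1163749280 * X * Y ^ 4 + 2027425600 * X ^ 2 * Y ^ 3 +
      1715790848 * X ^ 3 * Y ^ 2 + 707796992 * X ^ 4 * Y + 114327552 * X ^ 5 := by
    subst hX hY
    simp only [quinticSub]
    ring
  have hnn : 0 ≤ 52773191680000 *
      (quinticSub t - 1 / 1000) := key ▸ by positivity
  linarith

/-! ### Positivity of the Hastings–McLeod solution -/

open Filter in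
theorem IsHastingsMcLeod.tendsto_hmRatio {u : ℝ → ℝ} (hu : IsHastingsMcLeod u) :
    Tendsto (hmRatio u) atBot (nhds 1) := by
  refine (Asymptotics.isEquivalent_iff_tendsto_one ?_).1 hu.isEquivalent_atBot
  filter_upwards [eventually_lt_atBot 0] with t ht
  exact (Real.sqrt_pos.2 (by linarith)).ne'

theorem hmRatio_sq (u : ℝ → ℝ) {t : ℝ} (ht : t < 0) :
    hmRatio u t ^ 2 = u t ^ 2 / (-t / 2) := by
  rw [hmRatio, div_pow, Real.sq_sqrt (by linarith)]

namespace IsHastingsMcLeod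

open Filter Set

variable {u : ℝ → ℝ}

theorem hasDerivAt (hu : IsHastingsMcLeod u) (t : ℝ) : HasDerivAt u (deriv u t) t :=
  (hu.differentiable t).hasDerivAt

theorem eventually_lt_sq (hu : IsHastingsMcLeod u) : ∀ᶠ t in atBot, -t / 4 < u t ^ 2 := by
  have h := (hu.tendsto_hmRatio.pow 2).eventually (lt_mem_nhds (by norm_num : (1 / 2 : ℝ) < 1 ^ 2))
  filter_upwards [h, eventually_lt_atBot 0] with t ht ht0
  rw [hmRatio_sq u ht0, lt_div_iff₀ (by linarith)] at ht
  linarith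

theorem eventually_pos (hu : IsHastingsMcLeod u) : ∀ᶠ t in atBot, 0 < u t := by
  filter_upwards [hu.tendsto_hmRatio.eventually (lt_mem_nhds zero_lt_one),
    eventually_lt_atBot 0] with t ht ht0
  have hs : 0 < √(-t / 2) := Real.sqrt_pos.2 (by linarith)
  simpa using (lt_div_iff₀ hs).1 ht

/-- A Hastings–McLeod solution has no zeros. -/
theorem ne_zero (hu : IsHastingsMcLeod u) (a : ℝ) : u a ≠ 0 := by
  intro hua
  by_cases hG : 0 ≤ a ∨ 0 ≤ deriv u a ^ 2 - (-a / 2 - u a ^ 2) ^ 2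
  · rcases lt_trichotomy (deriv u a) 0 with hva | hva | hva
    · refine not_tendsto_zero_of_rising (u := fun t => -u t) (v := fun t => -deriv u t)
        (fun t => (hu.hasDerivAt t).neg) (fun t => (hu.painleve t).neg.congr_deriv (by ring))
        (a := a) (by simpa using hua) (by simpa using hva) ?_ ?_
      · simpa using hG
      · simpa using hu.tendsto_atTop.neg
    · obtain ⟨t, ht, hta⟩ := (hu.eventually_pos.and (eventually_le_atBot a)).exists
      exact ht.ne' (eq_zero_of_initial_eq_zero hu.hasDerivAt hu.painleve hua hva hta)
    · exact not_tendsto_zero_of_rising hu.hasDerivAt hu.painleve hua hva hG hu.tendsto_atTop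
  · push Not at hG
    -- Beyond `2 * a` the asymptotic bound `-t/4 < u²` contradicts the trapping bound `u² ≤ -a/2`.
    obtain ⟨t, ⟨ht, hta⟩, hta'⟩ := ((hu.eventually_lt_sq.and (eventually_le_atBot a)).and
      (eventually_lt_atBot (2 * a))).exists
    have := sq_le_of_trapped hu.hasDerivAt hu.painleve (a := a) (by rw [hua]; linarith [hG.1])
      hG.2 hta
    linarith

theorem pos (hu : IsHastingsMcLeod u) (t : ℝ) : 0 < u t := by
  obtain ⟨s, hs, hst⟩ := (hu.eventually_pos.and (eventually_le_atBot t)).exists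
  by_contra! ht
  obtain ⟨c, -, hc⟩ := intermediate_value_Icc' hst hu.differentiable.continuous.continuousOn
    (⟨ht, hs.le⟩ : (0 : ℝ) ∈ Icc (u t) (u s))
  exact hu.ne_zero c hc

theorem hmRatio_pos (hu : IsHastingsMcLeod u) {t : ℝ} (ht : t < 0) : 0 < hmRatio u t :=
  div_pos (hu.pos t) (Real.sqrt_pos.2 (by linarith))

/-! ### Minima of the ratio -/

/-- At a local minimum the ratio satisfies `1 - 1 / (4 |t|³) ≤ z²`. -/
theorem le_hmRatio_sq_of_isLocalMin (hu : IsHastingsMcLeod u) {t : ℝ} (ht : t < 0)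
    (hmin : IsLocalMin (hmRatio u) t) : 1 + 1 / (4 * t ^ 3) ≤ hmRatio u t ^ 2 := by
  set z := hmRatio u t with hz
  have hz0 : 0 < z := hu.hmRatio_pos ht
  have hneg : ∀ᶠ s in nhds t, s < 0 := gt_mem_nhds ht
  have hs0 : 0 < √(-t / 2) := Real.sqrt_pos.2 (by linarith)
  have hsq : √(-t / 2) ^ 2 = -t / 2 := Real.sq_sqrt (by linarith)
  have hroot : ∀ s < 0, HasDerivAt (fun s : ℝ => √(-s / 2)) (-(1 / 4) * (√(-s / 2))⁻¹) s := by
    intro s hs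
    have hpos : 0 < √(-s / 2) := Real.sqrt_pos.2 (by linarith)
    have h := ((hasDerivAt_id' s).neg.div_const 2).sqrt (by simp; linarith)
    refine h.congr_deriv ?_
    simp only [Pi.neg_apply]
    field_simp
    norm_num
  have hroot' : HasDerivAt (fun s : ℝ => -(1 / 4) * (√(-s / 2))⁻¹)
      (-(1 / 16) / √(-t / 2) ^ 3) t := by
    refine (((hroot t ht).inv hs0.ne').const_mul (-(1 / 4))).congr_deriv ?_
    field_simp
    norm_num
  have hut : u t = z * √(-t / 2) := by rw [hz, hmRatio, div_mul_cancel₀ _ hs0.ne']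
  have key := second_deriv_le_of_touch (f := fun s => z * √(-s / 2)) (g := u)
    (hneg.mono fun s hs => (hroot s hs).const_mul z) (hroot'.const_mul z)
    (Eventually.of_forall hu.hasDerivAt) (hu.painleve t)
    (by
      filter_upwards [hmin, hneg] with s hs hs'
      have : 0 < √(-s / 2) := Real.sqrt_pos.2 (by linarith)
      exact (le_div_iff₀ this).1 hs) hut.symm
  rw [hut] at key
  set r := √(-t / 2)
  have htr : t = -2 * r ^ 2 := by linarith
  have h1 : -(1 / 16) ≤ (t * r + 2 * z ^ 2 * r ^ 3) * r ^ 3 := by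
    rw [← div_le_iff₀ (by positivity)]
    refine le_of_mul_le_mul_left (key.trans_eq ?_) hz0
    ring
  have h2 : 1 + 1 / (4 * t ^ 3) = 1 - (1 / 32) / r ^ 6 := by
    rw [htr]
    field_simp
    ring
  rw [h2, sub_le_iff_le_add, ← sub_le_iff_le_add', le_div_iff₀ (by positivity)]
  rw [htr] at h1
  nlinarith

/-- Unlike the ratio, this quotient is continuous across `t = 0`, so compactness applies up to the
origin. -/
theorem continuous_neg_div_sq (hu : IsHastingsMcLeod u) : Continuous fun t => -t / u t ^ 2 :=
  continuous_neg.div (hu.differentiable.continuous.pow 2) fun t => (pow_pos (hu.pos t) 2).ne'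

theorem neg_div_sq_eq (hu : IsHastingsMcLeod u) {t : ℝ} (ht : t < 0) :
    -t / u t ^ 2 = 2 / hmRatio u t ^ 2 := by
  have := hu.pos t
  rw [hmRatio_sq u ht]
  field_simp

theorem tendsto_neg_div_sq (hu : IsHastingsMcLeod u) :
    Tendsto (fun t => -t / u t ^ 2) atBot (nhds 2) := by
  have h : Tendsto (fun t => 2 / hmRatio u t ^ 2) atBot (nhds (2 / 1 ^ 2)) :=
    tendsto_const_nhds.div (hu.tendsto_hmRatio.pow 2) (by norm_num)
  norm_num at h
  refine h.congr' ?_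
  filter_upwards [eventually_lt_atBot 0] with t ht using (hu.neg_div_sq_eq ht).symm

/-- If `-t / u²` exceeds its limit `2` on `(-∞, a]`, it attains its maximum there. -/
theorem exists_max_neg_div_sq (hu : IsHastingsMcLeod u) {a b : ℝ} (hba : b ≤ a)
    (hb : 2 < -b / u b ^ 2) :
    ∃ c ≤ a, 2 < -c / u c ^ 2 ∧ ∀ t ≤ a, -t / u t ^ 2 ≤ -c / u c ^ 2 := by
  obtain ⟨N, hN⟩ := eventually_atBot.1 (hu.tendsto_neg_div_sq.eventually (gt_mem_nhds hb))
  have hbN : N ≤ b := by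
    by_contra! h
    exact lt_irrefl _ (hN b h.le)
  obtain ⟨c, hc, hmax⟩ := isCompact_Icc.exists_isMaxOn (nonempty_Icc.2 (hbN.trans hba))
    hu.continuous_neg_div_sq.continuousOn
  have hbc : -b / u b ^ 2 ≤ -c / u c ^ 2 := hmax ⟨hbN, hba⟩
  refine ⟨c, hc.2, hb.trans_le hbc, fun t ht => ?_⟩
  rcases le_total N t with h | h
  · exact hmax ⟨h, ht⟩
  · exact (hN t h).le.trans hbc

/-- The ratio is minimal where `-t / u²` is maximal. -/
theorem hmRatio_le_of_neg_div_sq_le (hu : IsHastingsMcLeod u) {s t : ℝ} (hs : s < 0) (ht : t < 0)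
    (h : -t / u t ^ 2 ≤ -s / u s ^ 2) : hmRatio u s ≤ hmRatio u t := by
  have h1 := hu.hmRatio_pos hs
  have h2 := hu.hmRatio_pos ht
  rw [hu.neg_div_sq_eq hs, hu.neg_div_sq_eq ht, div_le_div_iff₀ (by positivity) (by positivity)]
    at h
  exact (pow_le_pow_iff_left₀ h1.le h2.le two_ne_zero).1 (by linarith)

/-- The ratio is less than `1` somewhere: otherwise `u` would be convex on `(-∞, 0)`. -/
theorem exists_two_lt_neg_div_sq (hu : IsHastingsMcLeod u) : ∃ t < 0, 2 < -t / u t ^ 2 := by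
  by_contra! hcon
  have hle : ∀ t < 0, -t ≤ 2 * u t ^ 2 := fun t ht =>
    (div_le_iff₀ (pow_pos (hu.pos t) 2)).1 (hcon t ht)
  have hmono : ∀ s t, s < t → t ≤ 0 → deriv u s ≤ deriv u t := by
    intro s t hst ht
    obtain ⟨c, hc, h⟩ := exists_sub_eq_deriv_mul hu.painleve hst
    have h1 := mul_nonneg (hu.pos c).le (by linarith [hle c (hc.2.trans_le ht)] :
      0 ≤ c + 2 * u c ^ 2)
    have h2 : 0 ≤ (c * u c + 2 * u c ^ 3) * (t - s) :=
      mul_nonneg (by linarith) (sub_pos.2 hst).le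
    linarith
  obtain ⟨ξ, hξ0, hξ⟩ : ∃ ξ < 0, deriv u ξ < 0 := by
    obtain ⟨t, ⟨ht, ht1⟩, ht2⟩ := ((hu.eventually_lt_sq.and (eventually_lt_atBot 0)).and
      (eventually_lt_atBot (-4 * u 0 ^ 2))).exists
    have h0 := hu.pos 0
    have hlt : u 0 < u t :=
      (pow_lt_pow_iff_left₀ h0.le (hu.pos t).le two_ne_zero).1 (by linarith)
    obtain ⟨c, hc, h⟩ := exists_sub_eq_deriv_mul hu.hasDerivAt ht1
    exact ⟨c, hc.2, by by_contra! hge; nlinarith [mul_nonneg hge (sub_pos.2 ht1).le]⟩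
  set κ := -deriv u ξ
  have hκ : 0 < κ := by simp only [κ]; linarith
  have hgrow : ∀ t < ξ, κ * (ξ - t) ≤ u t := by
    intro t ht
    obtain ⟨c, hc, h⟩ := exists_sub_eq_deriv_mul hu.hasDerivAt ht
    have h1 := hmono c ξ hc.2 hξ0.le
    have h2 : deriv u c * (ξ - t) ≤ -κ * (ξ - t) :=
      mul_le_mul_of_nonneg_right (by simp only [κ]; linarith) (sub_pos.2 ht).le
    linarith [hu.pos ξ]
  have hup : ∀ᶠ t in atBot, u t ^ 2 < -t := by
    filter_upwards [hu.tendsto_neg_div_sq.eventually (lt_mem_nhds one_lt_two)] with t ht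
    simpa using (lt_div_iff₀ (pow_pos (hu.pos t) 2)).1 ht
  -- For `t < 2ξ` the linear growth gives `u ≥ κ|t|/2`; with `u² < |t|` this forces `|t| < 4/κ²`.
  obtain ⟨t, ⟨ht, ht1⟩, ht2⟩ := ((hup.and (eventually_lt_atBot (2 * ξ))).and
    (eventually_lt_atBot (-(4 / κ ^ 2)))).exists
  have hg := hgrow t (by linarith)
  have h1 : κ * (-t / 2) ≤ u t := le_trans (mul_le_mul_of_nonneg_left (by linarith) hκ.le) hg
  have h2 : (κ * (-t / 2)) ^ 2 ≤ u t ^ 2 := by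
    have : 0 ≤ κ * (-t / 2) := mul_nonneg hκ.le (by linarith)
    gcongr
  have h3 : 4 < -t * κ ^ 2 := (div_lt_iff₀ (by positivity)).1 (by linarith)
  nlinarith

/-- To the left of `-2` the ratio cannot drop below a bound `κ ≤ 97/100` valid at `-2`. -/
theorem le_hmRatio_of_le_neg_two (hu : IsHastingsMcLeod u) {κ : ℝ} (hκ : κ ≤ 97 / 100)
    (h2 : κ ≤ hmRatio u (-2)) {t : ℝ} (ht : t ≤ -2) : κ ≤ hmRatio u t := by
  by_contra! hlt
  have hz := hu.hmRatio_pos (by linarith : t < 0)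
  have ht2 : 2 < -t / u t ^ 2 := by
    rw [hu.neg_div_sq_eq (by linarith), lt_div_iff₀ (by positivity)]
    nlinarith
  obtain ⟨c, hc, -, hmax⟩ := hu.exists_max_neg_div_sq ht ht2
  have hc0 : c < 0 := by linarith
  have hmin : ∀ s ≤ -2, hmRatio u c ≤ hmRatio u s := fun s hs =>
    hu.hmRatio_le_of_neg_div_sq_le hc0 (by linarith) (hmax s hs)
  have hct : hmRatio u c < κ := (hmin t ht).trans_lt hlt
  rcases hc.eq_or_lt with rfl | hc
  · linarith
  have hloc : IsLocalMin (hmRatio u) c := by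
    filter_upwards [gt_mem_nhds hc] with s hs using hmin s hs.le
  have h1 := hu.le_hmRatio_sq_of_isLocalMin hc0 hloc
  -- A minimum left of `-2` has `z² ≥ 31/32 > (97/100)²`.
  have h3 : -(1 / 32) ≤ 1 / (4 * c ^ 3) := by
    have : 8 ≤ (-c) ^ 3 := by
      calc (8 : ℝ) = 2 ^ 3 := by norm_num
        _ ≤ (-c) ^ 3 := by gcongr; linarith
    rw [le_div_iff_of_neg (by nlinarith)]
    nlinarith
  have := hu.hmRatio_pos hc0
  nlinarith

/-- Comparison by scaling: for the largest quotient `M` of the quintic by `u`, the function `M * u`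
touches the quintic from above. -/
theorem quinticSub_le (hu : IsHastingsMcLeod u) {t : ℝ} (h1 : -(5 / 2) ≤ t) (h2 : t ≤ 2) :
    quinticSub t ≤ u t := by
  by_contra! hlt
  have cp : Continuous quinticSub :=
    continuous_iff_continuousAt.2 fun t => (hasDerivAt_quinticSub t).continuousAt
  obtain ⟨c, hc, hmax⟩ := isCompact_Icc.exists_isMaxOn (nonempty_Icc.2 (h1.trans h2))
    (cp.div hu.differentiable.continuous fun t => (hu.pos t).ne').continuousOn
  set M := quinticSub c / u c with hM
  have hM1 : 1 < M := lt_of_lt_of_le ((one_lt_div (hu.pos t)).2 hlt) (hmax ⟨h1, h2⟩)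
  have hle : ∀ s ∈ Icc (-(5 / 2) : ℝ) 2, quinticSub s ≤ M * u s := fun s hs =>
    (div_le_iff₀ (hu.pos s)).1 (hmax hs)
  have hcM : quinticSub c = M * u c := by rw [hM, div_mul_cancel₀ _ (hu.pos c).ne']
  have hcpos : 0 < quinticSub c := hcM ▸ mul_pos (by linarith) (hu.pos c)
  have hc2 : c ≠ 2 := by
    rintro rfl
    norm_num [quinticSub] at hcpos
  -- At `-2` the quintic exceeds `97/100` and `√(-t/2) = 1`, so the ratio there is at least
  -- `97/(100M)`. This bound propagates to `-5/2`, where contact would need the quintic to be at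
  -- least `(97/100)√(5/4)`; it is slightly smaller.
  have hcl : c ≠ -(5 / 2) := by
    rintro rfl
    have hz2 : hmRatio u (-2) = u (-2) := by simp [hmRatio]
    have hp2 := hle (-2) (by norm_num)
    have hq2 : (97 / 100 : ℝ) < quinticSub (-2) := by norm_num [quinticSub]
    have hlow := hu.le_hmRatio_of_le_neg_two (κ := 97 / 100 / M) (div_le_self (by norm_num) hM1.le)
      (by rw [hz2, div_le_iff₀ (by linarith)]; linarith) (t := -(5 / 2)) (by norm_num)
    have hs : 0 < √(-(-(5 / 2)) / 2 : ℝ) := Real.sqrt_pos.2 (by norm_num)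
    rw [hmRatio, div_le_div_iff₀ (by linarith) hs, mul_comm (u _), ← hcM] at hlow
    have hsq := pow_le_pow_left₀ (by positivity) hlow 2
    rw [mul_pow, Real.sq_sqrt (by norm_num)] at hsq
    norm_num [quinticSub] at hsq
  have hcl' := lt_of_le_of_ne hc.1 hcl.symm
  have hc2' := lt_of_le_of_ne hc.2 hc2
  have key := second_deriv_le_of_touch (Eventually.of_forall hasDerivAt_quinticSub)
    (hasDerivAt_quinticSubDeriv c)
    (Eventually.of_forall fun s => (hu.hasDerivAt s).const_mul M) ((hu.painleve c).const_mul M)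
    (by filter_upwards [Icc_mem_nhds hcl' hc2'] with s hs using hle s hs) hcM
  have hsub := (quinticSub_isSubsolution hc.1 hc.2).trans key
  rw [hcM] at hsub
  have h3 : 0 < 2 * M * u c ^ 3 * (M ^ 2 - 1) :=
    mul_pos (mul_pos (by linarith) (pow_pos (hu.pos c) 3)) (by nlinarith)
  linarith

end IsHastingsMcLeod

/-! ### Conclusion -/

theorem mainTheorem7 (u : ℝ → ℝ) (hu : IsHastingsMcLeod u) :
    -- every local minimum of the ratio to the left of `-11/8` is large
    (∀ t : ℝ, t < -(11 / 8) → IsLocalMin (hmRatio u) t →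
      √(1203 / 1331) < hmRatio u t) ∧
    -- the ratio is large on `[-11/8, 0)`
    (∀ t ∈ Set.Ico (-(11 / 8) : ℝ) 0, √(1203 / 1331) < hmRatio u t) ∧
    -- the minimum `m` of the ratio on `(-∞, 0)` and the minimal constant `k₀` exist, and the bounds hold
    (∃ m k₀ : ℝ,
      IsLeast (hmRatio u '' Set.Iio 0) m ∧
      √(1203 / 1331) < m ∧
      IsLeast {k : ℝ | ∀ t : ℝ, 0 ≤ t + k * u t ^ 2} k₀ ∧
      0 < k₀ ∧
      k₀ = 2 * (m ^ 2)⁻¹ ∧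
      k₀ < 2662 / 1203 ∧
      (2662 / 1203 : ℝ) < 10 / 3) := by
  have part1 : ∀ t : ℝ, t < -(11 / 8) → IsLocalMin (hmRatio u) t →
      √(1203 / 1331) < hmRatio u t := by
    intro t ht hmin
    have h1 := hu.le_hmRatio_sq_of_isLocalMin (by linarith) hmin
    rw [Real.sqrt_lt' (hu.hmRatio_pos (by linarith))]
    refine lt_of_lt_of_le ?_ h1
    have h3 : (11 / 8 : ℝ) ^ 3 < (-t) ^ 3 := by
      gcongr
      linarith
    -- Here `4 * (11/8)³ = 1331/128`, whence `1203/1331 = 1 - 128/1331`.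
    have h4 : -(128 / 1331) < 1 / (4 * t ^ 3) := by
      rw [lt_div_iff_of_neg (by nlinarith)]
      nlinarith
    linarith
  have part2 : ∀ t ∈ Set.Ico (-(11 / 8) : ℝ) 0, √(1203 / 1331) < hmRatio u t := by
    rintro t ⟨ht, ht0⟩
    rw [Real.sqrt_lt' (hu.hmRatio_pos ht0), hmRatio_sq u ht0, lt_div_iff₀ (by linarith)]
    refine (lt_quinticSub_sq ht ht0.le).trans_le ?_
    exact pow_le_pow_left₀ (quinticSub_pos ht ht0.le).le
      (hu.quinticSub_le (by linarith) (by linarith)) 2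
  refine ⟨part1, part2, ?_⟩
  obtain ⟨b, hb0, hb⟩ := hu.exists_two_lt_neg_div_sq
  obtain ⟨c, hc, hc2, hmax⟩ := hu.exists_max_neg_div_sq hb0.le hb
  have hc0 : c < 0 := by
    rcases hc.eq_or_lt with rfl | h
    · norm_num at hc2
    · exact h
  have hmin : ∀ t < 0, hmRatio u c ≤ hmRatio u t := fun t ht =>
    hu.hmRatio_le_of_neg_div_sq_le hc0 ht (hmax t ht.le)
  have hm : √(1203 / 1331) < hmRatio u c := by
    rcases lt_or_ge c (-(11 / 8)) with h | h
    · refine part1 c h ?_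
      filter_upwards [gt_mem_nhds hc0] with s hs using hmin s hs
    · exact part2 c ⟨h, hc0⟩
  have hz := hu.hmRatio_pos hc0
  have hk : -c / u c ^ 2 = 2 / hmRatio u c ^ 2 := hu.neg_div_sq_eq hc0
  refine ⟨hmRatio u c, -c / u c ^ 2, ⟨⟨c, hc0, rfl⟩, ?_⟩, hm, ⟨?_, ?_⟩, by linarith, ?_, ?_,
    by norm_num⟩
  · rintro _ ⟨t, ht, rfl⟩
    exact hmin t ht
  · intro t
    rcases le_total t 0 with ht | ht
    · have := (div_le_iff₀ (pow_pos (hu.pos t) 2)).1 (hmax t ht)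
      linarith
    · have := mul_nonneg (by linarith : 0 ≤ -c / u c ^ 2) (sq_nonneg (u t))
      linarith
  · intro k hk
    rw [div_le_iff₀ (pow_pos (hu.pos c) 2)]
    linarith [hk c]
  · rw [hk, div_eq_mul_inv]
  · rw [Real.sqrt_lt' hz] at hm
    rw [hk, div_lt_div_iff₀ (by positivity) (by norm_num)]
    linarith
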